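/- Let $\mathcal R$ be a finite commutative chain ring with maximal ideal $\langle\gamma\rangle$, let $e$ be the nilpotency index of $\gamma$, and let $\overline{\mathcal R}=\mathcal R/\langle\gamma\rangle$ be the residue field, with $p^m$ elements, $p$ prime; write $r\mapsto\overline r$ for reduction modulo $\gamma$, also coefficientwise on vectors and polynomials. Let $\zeta\in\mathcal R$ have multiplicative order $p^m-1$, and let $\mathcal T=\{0,1,\zeta,\dots,\zeta^{p^m-2}\}$ be the Teichmüller set. Let $\lambda=\alpha+\gamma\beta$ with $0\ne\alpha\in\mathcal T$, $\beta$ a unit of $\mathcal R$ and $\overline\lambda\neq 1$. Let $n\ge 1$ and $s\ge 0$ be integers with $\gcd(n,p)=1$, and put $N=np^s$. Let $\alpha_0\in\mathcal T$ satisfy $\alpha_0^{p^s}=\alpha$, and let $x^n-\alpha_0=f_1(x)\cdots f_r(x)$ with monic, pairwise coprime $f_\ell\in\mathcal R[x]$ that are basic irreducible (that is, $\overline{f_\ell}$ is irreducible over $\overline{\mathcal R}$); put $d_\ell=\deg f_\ell$. For a commutative ring $R$ and a unit $\eta\in R$, identify $(a_0,\dots,a_{N-1})\in R^N$ with the class of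 $a_0+a_1x+\cdots+a_{N-1}x^{N-1}$ in $R[x]/\langle x^N-\eta\rangle$. An $\eta$-constacyclic code of length $N$ over $R$ is a submodule of $R^N$ closed under $(a_0,\dots,a_{N-1})\mapsto(\eta a_{N-1},a_0,\dots,a_{N-2})$; equivalently, an ideal of $R[x]/\langle x^N-\eta\rangle$. The derivative is $D(a_0,\dots,a_{M-1})=(a_1-a_0,\dots,a_{M-1}-a_{M-2})$. The depth of $a\in R^N$ is the smallest $i$ with $0\le i\le N-1$ and $D^i(a)=0$, and it is $N$ if there is no such $i$. $\mathrm{Depth}(\mathcal C)$ is the set of those $i\in\{1,\dots,N\}$ that are the depth of a codeword of $\mathcal C$. The $i$th torsion code of a code $\mathcal C$ over $\mathcal R$ is $\mathrm{Tor}_i(\mathcal C)=\{\overline a : a\in\mathcal R^N,\ \gamma^i a\in\mathcal C\}$. Then every $\lambda$-constacyclic code $\mathcal C$ of length $np^s$ over $\mathcal R$ is of the form $\mathcal C=\langle\prod_{\ell=1}^r f_\ell(x)^{k_\ell}\rangle$ with integers $0\le k_\ell\le ep^s$. For any such $k_\ell$, put $\tau_\ell(i)=\min\{(i+1)p^s,k_\ell\}-\min\{ip^s,k_\ell\}$.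 Then $$\mathrm{Tor}_i(\mathcal C)=\Big\langle\prod_{\ell=1}^r\overline{f_\ell(x)}^{\,\tau_\ell(i)}\Big\rangle\subseteq\overline{\mathcal R}[x]/\langle x^{np^s}-\overline\lambda\rangle\qquad(0\le i\le e-1),$$ the number $\mathcal S_1(\mathcal C)=\sum_{\ell=1}^r d_\ell\,\tau_\ell(e-1)$ is the degree of the generator $\prod_\ell\overline{f_\ell(x)}^{\,\tau_\ell(e-1)}$ of $\mathrm{Tor}_{e-1}(\mathcal C)$, and $$\mathrm{Depth}(\mathcal C)=\{\mathcal S_1(\mathcal C)+1,\mathcal S_1(\mathcal C)+2,\dots,np^s\}$$ (the empty set if $\mathcal S_1(\mathcal C)=np^s$). -/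

import Mathlib

open Polynomial

noncomputable section

namespace Constacyclic

/-- A chain ring: the ideals are totally ordered by inclusion. -/
def IsChainRing (R : Type*) [CommRing R] : Prop :=
  Nontrivial R ∧ ∀ I J : Ideal R, I ≤ J ∨ J ≤ I

/-- The Teichmüller set `{0, 1, ζ, …, ζ ^ (q - 2)}`, where `q` is the order of the residue field
and `ζ` has multiplicative order `q - 1`. -/
def teichmullerSet {R : Type*} [CommRing R] (q : ℕ) (ζ : R) : Set R :=
  {x | x = 0 ∨ ∃ i, i < q - 1 ∧ x = ζ ^ i}

/-- The derivative `R ^ N → R ^ (N - 1)`,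
`(a_0, …, a_{N-1}) ↦ (a_1 - a_0, …, a_{N-1} - a_{N-2})`. -/
def vecDeriv {R : Type*} [CommRing R] {N : ℕ} (a : Fin N → R) : Fin (N - 1) → R :=
  fun i => a ⟨i.1 + 1, by have := i.2; omega⟩ - a ⟨i.1, by have := i.2; omega⟩

/-- The iterated derivative `D ^ i : R ^ N → R ^ (N - i)`. -/
def iterDeriv {R : Type*} [CommRing R] {N : ℕ} (a : Fin N → R) : (i : ℕ) → Fin (N - i) → R
  | 0 => a
  | i + 1 => vecDeriv (iterDeriv a i)

open Classical in
/-- The depth of a vector `a` of length `N`: the smallest `i` with `0 ≤ i ≤ N - 1` and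
`D ^ i a = 0` if there is one, and `N` otherwise. -/
def depth {R : Type*} [CommRing R] {N : ℕ} (a : Fin N → R) : ℕ :=
  if h : ∃ i, i < N ∧ iterDeriv a i = 0 then Nat.find h else N

/-- The depth spectrum of a code of length `N`. -/
def depthSpectrum {R : Type*} [CommRing R] {N : ℕ} (C : Submodule R (Fin N → R)) : Set ℕ :=
  {i | 1 ≤ i ∧ i ≤ N ∧ ∃ c ∈ C, depth c = i}

/-- The constacyclic shift `(a_0, …, a_{N-1}) ↦ (lam * a_{N-1}, a_0, …, a_{N-2})`. -/
def constaShift {R : Type*} [CommRing R] {N : ℕ} (lam : R) (a : Fin N → R) : Fin N → R :=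
  fun i => if i.1 = 0 then lam * a ⟨N - 1, by have := i.2; omega⟩
    else a ⟨i.1 - 1, by have := i.2; omega⟩

/-- A linear code of length `N` is `lam`-constacyclic if it is closed under the shift. -/
def IsConstacyclic {R : Type*} [CommRing R] {N : ℕ} (lam : R) (C : Submodule R (Fin N → R)) :
    Prop :=
  ∀ a ∈ C, constaShift lam a ∈ C

/-- The ring `R[x] / ⟨x ^ N - lam⟩`. -/
abbrev QuotRing {R : Type*} [CommRing R] (N : ℕ) (lam : R) : Type _ :=
  R[X] ⧸ Ideal.span {(X ^ N - C lam : R[X])}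

/-- The standard identification of `R ^ N` with `R[x] / ⟨x ^ N - lam⟩`, which sends
`(a_0, …, a_{N-1})` to the class of `a_0 + a_1 x + ⋯ + a_{N-1} x ^ (N - 1)`. -/
def toQuot {R : Type*} [CommRing R] (N : ℕ) (lam : R) : (Fin N → R) →ₗ[R] QuotRing N lam where
  toFun a := Ideal.Quotient.mk _ (∑ i : Fin N, C (a i) * X ^ (i : ℕ))
  map_add' a b := by
    rw [← map_add, ← Finset.sum_add_distrib]
    simp only [Pi.add_apply, C_add, add_mul]
  map_smul' c a := by
    rw [RingHom.id_apply, ← Ideal.Quotient.mk_eq_mk, ← Ideal.Quotient.mk_eq_mk,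
      ← Submodule.Quotient.mk_smul, Finset.smul_sum]
    simp only [Pi.smul_apply, smul_eq_mul, C_mul, smul_eq_C_mul, mul_assoc]

/-- The code of length `N` that corresponds to the ideal `⟨g⟩` of `R[x] / ⟨x ^ N - lam⟩`. -/
def codeGen {R : Type*} [CommRing R] (N : ℕ) (lam : R) (g : R[X]) : Submodule R (Fin N → R) :=
  Submodule.comap (toQuot N lam)
    (Submodule.restrictScalars R
      (Ideal.span {(Ideal.Quotient.mk (Ideal.span {(X ^ N - C lam : R[X])}) g)}))

/-- The residue field `R / ⟨γ⟩`. -/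
abbrev Res {R : Type*} [CommRing R] (γ : R) : Type _ := R ⧸ Ideal.span {γ}

/-- The natural epimorphism `R → R / ⟨γ⟩`. -/
abbrev res {R : Type*} [CommRing R] (γ : R) : R →+* Res γ := Ideal.Quotient.mk (Ideal.span {γ})

/-- The `i`-th torsion code: the coordinatewise reductions modulo `γ` of all vectors `a` for which
`γ ^ i • a` belongs to the code. -/
def torsionCode {R : Type*} [CommRing R] {N : ℕ} (γ : R) (i : ℕ) (C : Submodule R (Fin N → R)) :
    Set (Fin N → Res γ) :=
  {b | ∃ a : Fin N → R, γ ^ i • a ∈ C ∧ b = fun j => res γ (a j)}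

/-- `τ(i) = min {(i + 1) P, k} - min {i P, k}`, to be used with `P = p ^ s`. -/
def tau (P k i : ℕ) : ℕ := min ((i + 1) * P) k - min (i * P) k

/-- `S₁ = ∑ d_ℓ τ_ℓ(e - 1)`, where `d_ℓ` is the degree of `f_ℓ`. -/
def sOne {R : Type*} [CommRing R] {r : ℕ} (f : Fin r → R[X]) (k : Fin r → ℕ) (P e : ℕ) : ℕ :=
  ∑ l, (f l).natDegree * tau P (k l) (e - 1)

end Constacyclic

end

/-! Work in `A = R[x]/⟨x^N - λ⟩` and let `π_ℓ` be the class of `f_ℓ`. As `γ ∣ p` and `β` is a unit,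
the binomial theorem makes `(x^n - α₀)^(p^s)`, that is `∏ π_ℓ^(p^s)`, a unit times `γ`
(`associated_quotMk_C_pow`). So `π_ℓ ∣ γ`, and a maximal ideal containing `π_ℓ` is generated by it.
Since `0` is a product of powers of the `π_ℓ`, peeling off one factor at a time shows that every
ideal is generated by such a product (`exists_eq_span_prod_pow`). A product vanishes only if all
exponents are at least `e p^s` (`prod_pow_eq_zero_iff`), so divisibility of products compares
exponents up to `e p^s`. As `γ` has exponent `p^s` at each `ℓ`, torsion codes reduce to the
arithmetic of `τ_ℓ(i) = min(p^s, k_ℓ - i p^s)`, with truncated subtraction.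

For depth, `D^i a = 0` holds exactly when `(1 - x)^i a` has a representative of degree less than
`i`, and `1 - x` is a unit of `A` because `λ` is not `1` modulo `γ`. Hence the spectrum depends only
on the least degree `S` of a nonzero codeword (`depthSpectrum_eq_Icc`). Multiplying by powers of `γ`
moves a codeword into `γ^(e-1) R^N`, where it is governed by `Tor_{e-1}`; so `S` is the degree of
the generator of that torsion code. -/

open Polynomial

namespace Constacyclic

/-! ### Vectors, polynomials and ideals of the quotient ring -/

section Quotient

variable {R : Type*} [CommRing R] {N : ℕ} {lam : R}

/-- The polynomial `a_0 + a_1 x + ⋯ + a_{N-1} x ^ (N - 1)` of a vector. -/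
noncomputable def toPoly (a : Fin N → R) : R[X] := ∑ i : Fin N, C (a i) * X ^ (i : ℕ)

/-- The quotient map `R[x] → R[x] / ⟨x ^ N - lam⟩`. -/
noncomputable abbrev quotMk (N : ℕ) (lam : R) : R[X] →+* QuotRing N lam := Ideal.Quotient.mk _

lemma toQuot_apply (a : Fin N → R) : toQuot N lam a = quotMk N lam (toPoly a) := rfl

lemma coeff_toPoly (a : Fin N → R) (m : ℕ) :
    (toPoly a).coeff m = if h : m < N then a ⟨m, h⟩ else 0 := by
  simp only [toPoly, finsetSum_coeff, coeff_C_mul, coeff_X_pow, mul_ite, mul_one, mul_zero]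
  split_ifs with h
  · rw [Finset.sum_eq_single ⟨m, h⟩]
    · simp
    · intro b _ hb
      rw [if_neg]
      rintro rfl
      exact hb rfl
    · simp
  · refine Finset.sum_eq_zero fun b _ => if_neg ?_
    have := b.2
    omega

lemma toPoly_coeff_fin (a : Fin N → R) (j : Fin N) : (toPoly a).coeff j = a j := by
  rw [coeff_toPoly, dif_pos j.2]

lemma degree_toPoly_lt (a : Fin N → R) : (toPoly a).degree < N := by
  rw [degree_lt_iff_coeff_zero]
  intro m hm
  rw [coeff_toPoly, dif_neg (by simpa using hm)]

lemma exists_toPoly {g : R[X]} (hg : g.degree < N) : ∃ a : Fin N → R, toPoly a = g := by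
  refine ⟨fun i => g.coeff i, ?_⟩
  ext m
  rw [coeff_toPoly]
  split_ifs with h
  · rfl
  · exact (coeff_eq_zero_of_degree_lt (hg.trans_le (by exact_mod_cast not_lt.mp h))).symm

lemma quotMk_eq_zero_iff {g : R[X]} : quotMk N lam g = 0 ↔ X ^ N - C lam ∣ g := by
  rw [Ideal.Quotient.eq_zero_iff_mem, Ideal.mem_span_singleton]

lemma quotMk_eq_iff {g h : R[X]} : quotMk N lam g = quotMk N lam h ↔ X ^ N - C lam ∣ g - h := by
  rw [← sub_eq_zero, ← map_sub, quotMk_eq_zero_iff]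

lemma quotMk_injOn [Nontrivial R] (hN : N ≠ 0) {g h : R[X]} (hg : g.degree < N)
    (hh : h.degree < N) (H : quotMk N lam g = quotMk N lam h) : g = h := by
  rw [quotMk_eq_iff] at H
  by_contra hne
  refine (monic_X_pow_sub_C lam hN).not_dvd_of_degree_lt (sub_ne_zero.mpr hne) ?_ H
  rw [degree_X_pow_sub_C (Nat.pos_of_ne_zero hN)]
  exact (degree_sub_le _ _).trans_lt (max_lt hg hh)

lemma toPoly_injective : Function.Injective (toPoly : (Fin N → R) → R[X]) := by
  intro a b h
  ext j
  rw [← toPoly_coeff_fin a, ← toPoly_coeff_fin b, h]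

lemma toQuot_injective [Nontrivial R] (hN : N ≠ 0) : Function.Injective (toQuot N lam) :=
  fun a b h => toPoly_injective
    (quotMk_injOn hN (degree_toPoly_lt a) (degree_toPoly_lt b) h)

lemma toQuot_surjective [Nontrivial R] (hN : N ≠ 0) : Function.Surjective (toQuot N lam) := by
  intro z
  obtain ⟨g, rfl⟩ := Ideal.Quotient.mk_surjective z
  have hm := monic_X_pow_sub_C lam hN
  have hd := degree_modByMonic_lt g hm
  rw [degree_X_pow_sub_C (Nat.pos_of_ne_zero hN)] at hd
  obtain ⟨a, ha⟩ := exists_toPoly hd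
  refine ⟨a, ?_⟩
  rw [toQuot_apply, quotMk_eq_iff, ha]
  refine ⟨-(g /ₘ (X ^ N - C lam)), ?_⟩
  linear_combination modByMonic_add_div g (X ^ N - C lam)

lemma smul_eq_quotMk_mul (c : R) (z : QuotRing N lam) : c • z = quotMk N lam (C c) * z := by
  obtain ⟨g, rfl⟩ := Ideal.Quotient.mk_surjective z
  rw [← map_mul, ← smul_eq_C_mul]
  rfl

lemma quotMk_X_pow : quotMk N lam X ^ N = quotMk N lam (C lam) := by
  rw [← map_pow, quotMk_eq_iff]

lemma toQuot_constaShift (a : Fin N → R) :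
    toQuot N lam (constaShift lam a) = quotMk N lam X * toQuot N lam a := by
  rcases N with _ | N
  · simp [toQuot_apply, toPoly]
  · rw [toQuot_apply, toQuot_apply, toPoly, toPoly, Fin.sum_univ_succ, Fin.sum_univ_castSucc]
    simp only [map_add, map_mul, map_sum, map_pow, mul_add, Finset.mul_sum]
    refine (add_comm _ _).trans ?_
    congr 1
    · refine Finset.sum_congr rfl fun i _ => ?_
      have : constaShift lam a i.succ = a i.castSucc := by
        simp [constaShift, Fin.castSucc, Fin.castAdd, Fin.castLE]
      rw [this, Fin.val_succ, Fin.val_castSucc]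
      ring
    · have : constaShift lam a 0 = lam * a (Fin.last N) := by
        simp [constaShift, Fin.last]
      have hX : quotMk (N + 1) lam X * quotMk (N + 1) lam X ^ N = quotMk (N + 1) lam (C lam) := by
        exact (pow_succ' _ _).symm.trans quotMk_X_pow
      rw [this, Fin.val_last, Fin.val_zero, C_mul, map_mul, ← hX]
      ring

lemma IsConstacyclic.exists_ideal [Nontrivial R] (hN : N ≠ 0) {Co : Submodule R (Fin N → R)}
    (h : IsConstacyclic lam Co) :
    ∃ I : Ideal (QuotRing N lam), ∀ a, a ∈ Co ↔ toQuot N lam a ∈ I := by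
  set M := Co.map (toQuot N lam) with hM
  have hX : ∀ z ∈ M, quotMk N lam X * z ∈ M := by
    rintro _ ⟨a, ha, rfl⟩
    exact ⟨_, h a ha, toQuot_constaShift a⟩
  have hXp : ∀ (m : ℕ), ∀ z ∈ M, quotMk N lam X ^ m * z ∈ M := by
    intro m
    induction m with
    | zero => simp
    | succ m ih =>
      intro z hz
      rw [pow_succ, mul_assoc]
      exact ih _ (hX z hz)
  have hg : ∀ (g : R[X]), ∀ z ∈ M, quotMk N lam g * z ∈ M := by
    intro g z hz
    induction g using Polynomial.induction_on' with
    | add p q hp hq =>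
      rw [map_add, add_mul]
      exact M.add_mem hp hq
    | monomial m c =>
      rw [← C_mul_X_pow_eq_monomial, map_mul, mul_assoc, ← smul_eq_quotMk_mul, map_pow]
      exact M.smul_mem c (hXp m z hz)
  refine ⟨{ carrier := M, add_mem' := M.add_mem, zero_mem' := M.zero_mem, smul_mem' := ?_ }, ?_⟩
  · intro c z hz
    obtain ⟨g, rfl⟩ := Ideal.Quotient.mk_surjective c
    exact hg g z hz
  · intro a
    constructor
    · exact fun ha => ⟨a, ha, rfl⟩
    · rintro ⟨b, hb, hab⟩
      rwa [← toQuot_injective hN hab]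

lemma mem_codeGen {g : R[X]} {a : Fin N → R} :
    a ∈ codeGen N lam g ↔ quotMk N lam g ∣ toQuot N lam a := by
  rw [← Ideal.mem_span_singleton]
  rfl

end Quotient

/-! ### Depth through multiplication by `1 - x` -/

section Depth

variable {R : Type*} [CommRing R] {N : ℕ} {lam : R}

lemma coeff_one_sub_X_mul (q : R[X]) (m : ℕ) :
    ((1 - X) * q).coeff (m + 1) = q.coeff (m + 1) - q.coeff m := by
  rw [sub_mul, one_mul, coeff_sub, coeff_X_mul]

lemma iterDeriv_eq_coeff (a : Fin N → R) (i : ℕ) (j : Fin (N - i)) :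
    iterDeriv a i j = ((1 - X) ^ i * toPoly a).coeff (j + i) := by
  induction i with
  | zero => rw [pow_zero, one_mul]; exact (toPoly_coeff_fin a j).symm
  | succ i ih =>
    rw [pow_succ', mul_assoc, ← add_assoc, coeff_one_sub_X_mul]
    change iterDeriv a i _ - iterDeriv a i _ = _
    rw [ih, ih]
    congr 2
    change (j : ℕ) + 1 + i = j + i + 1
    ring

lemma iterDeriv_eq_zero_iff (a : Fin N → R) (i : ℕ) :
    iterDeriv a i = 0 ↔ ∀ m, i ≤ m → m < N → ((1 - X) ^ i * toPoly a).coeff m = 0 := by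
  constructor
  · intro h m him hm
    have := iterDeriv_eq_coeff a i ⟨m - i, by omega⟩
    rw [h] at this
    simpa [Nat.sub_add_cancel him] using this.symm
  · intro h
    ext j
    rw [iterDeriv_eq_coeff]
    exact h _ (by omega) (by have := j.2; omega)

lemma iterDeriv_eq_zero_mono {a : Fin N → R} {i j : ℕ} (hij : i ≤ j) (h : iterDeriv a i = 0) :
    iterDeriv a j = 0 := by
  induction j, hij using Nat.le_induction with
  | base => exact h
  | succ j _ ih =>
    ext m
    change iterDeriv a j _ - iterDeriv a j _ = 0
    simp [ih]

open Classical in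
lemma iterDeriv_depth_eq_zero (a : Fin N → R) : iterDeriv a (depth a) = 0 := by
  by_cases h : ∃ i, i < N ∧ iterDeriv a i = 0
  · rw [depth, dif_pos h]
    exact (Nat.find_spec h).2
  · rw [depth, dif_neg h]
    ext j
    have := j.2
    omega

open Classical in
lemma depth_zero (hN : N ≠ 0) : depth (0 : Fin N → R) = 0 := by
  have hx : ∃ i, i < N ∧ iterDeriv (0 : Fin N → R) i = 0 := ⟨0, Nat.pos_of_ne_zero hN, rfl⟩
  rw [depth, dif_pos hx, ← Nat.le_zero]
  exact Nat.find_min' hx ⟨Nat.pos_of_ne_zero hN, rfl⟩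

open Classical in
lemma depth_eq_of {a : Fin N → R} {i : ℕ} (hi : i + 1 ≤ N) (h : iterDeriv a (i + 1) = 0)
    (h' : iterDeriv a i ≠ 0) : depth a = i + 1 := by
  refine le_antisymm ?_ ?_
  · unfold depth
    split_ifs with hx
    · rcases hi.lt_or_eq with hlt | heq
      · exact Nat.find_min' hx ⟨hlt, h⟩
      · rw [heq]
        exact (Nat.find_spec hx).1.le
    · by_contra hlt
      exact hx ⟨i + 1, by omega, h⟩
  · by_contra hlt
    exact h' (iterDeriv_eq_zero_mono (by omega) (iterDeriv_depth_eq_zero a))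

lemma coeff_one_sub_X_pow_mul_toPoly (a : Fin N → R) (i : ℕ) {m : ℕ} (hm : N + i ≤ m) :
    ((1 - X) ^ i * toPoly a).coeff m = 0 := by
  induction i generalizing m with
  | zero => rw [pow_zero, one_mul, coeff_toPoly, dif_neg (by omega)]
  | succ i ih =>
    obtain ⟨m, rfl⟩ : ∃ m', m = m' + 1 := ⟨m - 1, by omega⟩
    rw [pow_succ', mul_assoc, coeff_one_sub_X_mul, ih (by omega), ih (by omega), sub_zero]

/-- The product has only `i` coefficients in degrees `N` and above; they wrap around with a factor
`lam`, landing below degree `i`. Coefficients `i, …, N - 1`, which form `D^i a`, are therefore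
unaffected. -/
lemma exists_quotMk_one_sub_X_pow_mul (a : Fin N → R) (i : ℕ) :
    ∃ v : R[X], v.degree < i ∧ quotMk N lam ((1 - X) ^ i) * toQuot N lam a =
      quotMk N lam
        (toPoly (fun j : Fin N => ((1 - X) ^ i * toPoly a).coeff j) + C lam * v) := by
  set q := (1 - X) ^ i * toPoly a with hq
  refine ⟨toPoly (fun j : Fin i => q.coeff (N + j)), degree_toPoly_lt _, ?_⟩
  have hdec : q = toPoly (fun j : Fin N => q.coeff j) +
      toPoly (fun j : Fin i => q.coeff (N + j)) * X ^ N := by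
    ext m
    rw [coeff_add, coeff_mul_X_pow', coeff_toPoly, coeff_toPoly]
    by_cases h1 : m < N
    · rw [dif_pos h1, if_neg (by omega), add_zero]
    · rw [dif_neg h1, if_pos (by omega), zero_add]
      by_cases h2 : m - N < i
      · rw [dif_pos h2]
        congr 1
        change m = N + (m - N)
        omega
      · rw [dif_neg h2]
        exact coeff_one_sub_X_pow_mul_toPoly a i (by omega)
  rw [toQuot_apply, ← map_mul, ← hq]
  nth_rewrite 1 [hdec]
  rw [map_add, map_mul, map_pow, quotMk_X_pow, map_add, map_mul, mul_comm]

lemma exists_quotMk_eq_of_iterDeriv_eq_zero {a : Fin N → R} {i : ℕ} (h : iterDeriv a i = 0) :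
    ∃ w : R[X], w.degree < i ∧
      quotMk N lam ((1 - X) ^ i) * toQuot N lam a = quotMk N lam w := by
  rw [iterDeriv_eq_zero_iff] at h
  obtain ⟨v, hv, hvq⟩ := exists_quotMk_one_sub_X_pow_mul (lam := lam) a i
  refine ⟨_, ?_, hvq⟩
  rw [degree_lt_iff_coeff_zero] at hv ⊢
  intro m hm
  rw [coeff_add, coeff_C_mul, hv m hm, mul_zero, add_zero, coeff_toPoly]
  split_ifs with hmN
  · exact h m hm hmN
  · rfl

lemma iterDeriv_eq_zero_of_quotMk_eq [Nontrivial R] {a : Fin N → R} {i : ℕ} (hi : i ≤ N)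
    (hN : N ≠ 0) {w : R[X]} (hw : w.degree < i)
    (h : quotMk N lam ((1 - X) ^ i) * toQuot N lam a = quotMk N lam w) : iterDeriv a i = 0 := by
  rw [iterDeriv_eq_zero_iff]
  obtain ⟨v, hv, hvq⟩ := exists_quotMk_one_sub_X_pow_mul (lam := lam) a i
  have hiN : ((i : ℕ) : WithBot ℕ) ≤ (N : ℕ) := by exact_mod_cast hi
  have hvN : (C lam * v).degree < (N : ℕ) := by
    rw [degree_lt_iff_coeff_zero] at hv ⊢
    intro m hm
    rw [coeff_C_mul, hv m (by omega), mul_zero]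
  have := quotMk_injOn hN ((degree_add_le _ _).trans_lt (max_lt (degree_toPoly_lt _) hvN))
    (hw.trans_le hiN) (hvq.symm.trans h)
  intro m him hmN
  have hc := congrArg (fun p => coeff p m) this
  rw [degree_lt_iff_coeff_zero] at hv hw
  simp only [coeff_add, coeff_C_mul, hv m him, hw m him, mul_zero, add_zero, coeff_toPoly,
    dif_pos hmN] at hc
  exact hc

/-- `1 - x` divides `1 - x^N`, which equals `1 - lam` in the quotient. -/
lemma isUnit_quotMk_one_sub_X (h : IsUnit (1 - lam)) : IsUnit (quotMk N lam (1 - X)) := by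
  refine isUnit_of_dvd_unit (map_dvd (quotMk N lam) (one_sub_dvd_one_sub_pow X N)) ?_
  rw [map_sub, map_pow, quotMk_X_pow, ← map_sub, ← C_1, ← C_sub]
  exact h.map ((quotMk N lam).comp C)

/-- If every nonzero word of a constacyclic code has degree at least `S` and some nonzero word has
degree at most `S`, then the depths of the nonzero words are exactly `S + 1, …, N`. -/
lemma depthSpectrum_eq_Icc [Nontrivial R] (hN : N ≠ 0) (hlam : IsUnit (1 - lam))
    {Co : Submodule R (Fin N → R)} {I : Ideal (QuotRing N lam)}
    (hI : ∀ a, a ∈ Co ↔ toQuot N lam a ∈ I) {S : ℕ} (hS : S ≤ N)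
    (hlow : ∀ a ∈ Co, (∀ j : Fin N, S ≤ j → a j = 0) → a = 0)
    (hex : S < N → ∃ a ∈ Co, a ≠ 0 ∧ ∀ j : Fin N, S < j → a j = 0) :
    depthSpectrum Co = Set.Icc (S + 1) N := by
  have hlow' : ∀ {w : R[X]}, w.degree < S → quotMk N lam w ∈ I → w = 0 := by
    intro w hw hwI
    obtain ⟨a, rfl⟩ := exists_toPoly (N := N) (hw.trans_le (by exact_mod_cast hS))
    rw [degree_lt_iff_coeff_zero] at hw
    rw [hlow a ((hI a).mpr hwI) fun j hj => by rw [← toPoly_coeff_fin a, hw j hj]]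
    simp [toPoly]
  have hu := isUnit_quotMk_one_sub_X (N := N) hlam
  have hupow : ∀ i, IsUnit (quotMk N lam ((1 - X) ^ i)) := fun i => by
    rw [map_pow]
    exact hu.pow i
  ext i
  constructor
  · rintro ⟨h1, hiN, a, ha, rfl⟩
    refine ⟨?_, hiN⟩
    by_contra hlt
    obtain ⟨w, hw, hwa⟩ :=
      exists_quotMk_eq_of_iterDeriv_eq_zero (lam := lam) (iterDeriv_depth_eq_zero a)
    have hw0 : w = 0 := by
      refine hlow' (hw.trans_le (by exact_mod_cast (by omega : depth a ≤ S))) ?_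
      rw [← hwa]
      exact I.mul_mem_left _ ((hI a).mp ha)
    rw [hw0, map_zero, (hupow _).mul_right_eq_zero] at hwa
    have ha0 : a = 0 := toQuot_injective hN (hwa.trans (map_zero _).symm)
    have : depth a ≤ 0 := by
      rw [ha0]
      exact (depth_zero hN).le
    omega
  · rintro ⟨hSi, hiN⟩
    obtain ⟨i, rfl⟩ : ∃ i', i = i' + 1 := ⟨i - 1, by omega⟩
    obtain ⟨b, hb, hb0, hbS⟩ := hex (by omega)
    have hbdeg : ∀ m, S < m → (toPoly b).coeff m = 0 := by
      intro m hm
      rw [coeff_toPoly]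
      split_ifs with hmN
      · exact hbS _ hm
      · rfl
    -- If `b = (x - 1) g`, then `g` also lies in the ideal because `1 - x` is a unit, and its degree
    -- is below the minimum `S`.
    have heval : (toPoly b).eval 1 ≠ 0 := by
      intro h0
      obtain ⟨g, hg⟩ := dvd_iff_isRoot.mpr h0
      have hgI : quotMk N lam g ∈ I := by
        have hbI := (hI b).mp hb
        have hneg : (X - C 1) * g = (1 - X) * -g := by
          rw [C_1]
          ring
        rwa [toQuot_apply, hg, hneg, map_mul, I.unit_mul_mem_iff_mem hu,
          map_neg, I.neg_mem_iff] at hbI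
      have hg0 : g = 0 := by
        by_contra hgne
        refine hgne (hlow' ?_ hgI)
        rw [degree_lt_iff_coeff_zero]
        intro m hm
        have hbd : (toPoly b).natDegree ≤ S := natDegree_le_iff_coeff_eq_zero.mpr hbdeg
        rw [hg, (monic_X_sub_C 1).natDegree_mul' hgne, natDegree_X_sub_C] at hbd
        exact coeff_eq_zero_of_natDegree_lt (by omega)
      exact hb0 (toPoly_injective (by rw [hg, hg0, mul_zero]; simp [toPoly]))
    -- The shift gives degree at most `i` and keeps the value at `1`; the word of depth `i + 1` is
    -- `(1 - x)^(-(i+1)) w`.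
    set w := X ^ (i - S) * toPoly b with hw
    have hwdeg : w.degree < (i + 1 : ℕ) := by
      rw [degree_lt_iff_coeff_zero]
      intro m hm
      rw [hw, coeff_X_pow_mul', if_pos (by omega), hbdeg _ (by omega)]
    have hwI : quotMk N lam w ∈ I := by
      rw [hw, map_mul]
      exact I.mul_mem_left _ ((hI b).mp hb)
    obtain ⟨u, huu⟩ := hupow (i + 1)
    obtain ⟨a, ha⟩ := toQuot_surjective hN ((↑u⁻¹ : QuotRing N lam) * quotMk N lam w)
    have haw : quotMk N lam ((1 - X) ^ (i + 1)) * toQuot N lam a = quotMk N lam w := by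
      rw [ha, ← huu, Units.mul_inv_cancel_left]
    refine ⟨by omega, hiN, a, ?_, ?_⟩
    · rw [hI, ha]
      exact I.mul_mem_left _ hwI
    · refine depth_eq_of hiN (iterDeriv_eq_zero_of_quotMk_eq hiN hN hwdeg haw) fun h0 => heval ?_
      -- If `D^i a = 0`, then `w = (1 - x) v` in the quotient; both degrees are below `N`, so this
      -- is an identity of polynomials and `w` vanishes at `1`.
      obtain ⟨v, hv, hva⟩ := exists_quotMk_eq_of_iterDeriv_eq_zero (lam := lam) h0
      rw [pow_succ', map_mul, mul_assoc, hva, ← map_mul] at haw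
      have hvdeg : ((1 - X) * v : R[X]).degree < (N : ℕ) := by
        rw [degree_lt_iff_coeff_zero] at hv ⊢
        intro m hm
        obtain ⟨m, rfl⟩ : ∃ m', m = m' + 1 := ⟨m - 1, by omega⟩
        rw [coeff_one_sub_X_mul, hv _ (by omega), hv _ (by omega), sub_zero]
      have := congrArg (eval 1) (quotMk_injOn hN hvdeg
        (hwdeg.trans_le (by exact_mod_cast hiN)) haw)
      simpa [hw] using this.symm

end Depth

/-! ### Ideals generated by products of powers -/

section PrincipalMaximal

variable {A ι : Type*} [CommRing A] [Fintype ι] {π : ι → A}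

lemma prod_pow_dvd_prod_pow {k m : ι → ℕ} (h : ∀ l, k l ≤ m l) :
    ∏ l, π l ^ k l ∣ ∏ l, π l ^ m l :=
  Finset.prod_dvd_prod_of_dvd _ _ fun l _ => pow_dvd_pow _ (h l)

lemma prod_pow_mul_prod_pow (k m : ι → ℕ) :
    (∏ l, π l ^ k l) * ∏ l, π l ^ m l = ∏ l, π l ^ (k l + m l) := by
  rw [← Finset.prod_mul_distrib]
  simp only [pow_add]

/-- In a ring whose elements `π l` generate every maximal ideal that contains them, each ideal
that contains a product of powers of the `π l` is generated by such a product. -/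
lemma exists_eq_span_prod_pow
    (hπ : ∀ l, ∀ M : Ideal A, M.IsMaximal → π l ∈ M → M = Ideal.span {π l})
    (m : ι → ℕ) (I : Ideal A) (hI : ∏ l, π l ^ m l ∈ I) :
    ∃ k : ι → ℕ, (∀ l, k l ≤ m l) ∧ I = Ideal.span {∏ l, π l ^ k l} := by
  classical
  induction hn : ∑ l, m l using Nat.strong_induction_on generalizing m I with
  | _ n ih =>
  by_cases htop : I = ⊤
  · exact ⟨0, fun _ => Nat.zero_le _, by simp [htop]⟩
  obtain ⟨M, hM, hIM⟩ := Ideal.exists_le_maximal I htop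
  obtain ⟨l, hl⟩ : ∃ l, π l ^ m l ∈ M := by
    have := hM.isPrime.prod_mem_iff.mp (hIM hI)
    simpa using this
  have hml : m l ≠ 0 := by
    intro h0
    rw [h0, pow_zero] at hl
    exact hM.ne_top ((Ideal.eq_top_iff_one M).mpr hl)
  have hMl := hπ l M hM (hM.isPrime.mem_of_pow_mem _ hl)
  set δ : ι → ℕ := Pi.single l 1 with hδ
  have hδl : δ l = 1 := by simp [hδ]
  have hδne : ∀ j, j ≠ l → δ j = 0 := fun j hj => by simp [hδ, hj]
  have hδprod : ∏ j, π j ^ δ j = π l := by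
    rw [Finset.prod_eq_single l (fun j _ hj => by rw [hδne j hj, pow_zero]) (by simp), hδl, pow_one]
  have hδm : ∀ j, δ j ≤ m j := by
    intro j
    by_cases hj : j = l
    · subst hj
      omega
    · simp [hδne j hj]
  -- The colon ideal `(I : π l)`. Since `I ⊆ M = ⟨π l⟩`, one has `I = π l * J`, and `J` contains a
  -- product of smaller total exponent.
  let J : Ideal A :=
    { carrier := {x | π l * x ∈ I}
      add_mem' := fun {x y} hx hy => by
        simpa only [Set.mem_ofPred_eq, mul_add] using I.add_mem hx hy
      zero_mem' := by simp
      smul_mem' := fun c x hx => by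
        simpa only [Set.mem_ofPred_eq, smul_eq_mul, mul_left_comm] using I.mul_mem_left c hx }
  have hJ : ∏ j, π j ^ (m j - δ j) ∈ J := by
    change π l * _ ∈ I
    rw [← hδprod, prod_pow_mul_prod_pow]
    simpa only [Nat.add_sub_cancel' (hδm _)] using hI
  have hlt : ∑ j, (m j - δ j) < n := by
    rw [← hn]
    exact Finset.sum_lt_sum (fun j _ => Nat.sub_le _ _) ⟨l, Finset.mem_univ _, by omega⟩
  obtain ⟨k, hk, hJk⟩ := ih _ hlt (fun j => m j - δ j) J hJ rfl
  refine ⟨fun j => δ j + k j, fun j => ?_, ?_⟩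
  · have := hk j
    have := hδm j
    change δ j + k j ≤ m j
    omega
  rw [← prod_pow_mul_prod_pow, hδprod]
  refine le_antisymm (fun x hx => ?_) ?_
  · have hxM := hIM hx
    rw [hMl, Ideal.mem_span_singleton] at hxM
    obtain ⟨y, rfl⟩ := hxM
    have hy : y ∈ J := hx
    rw [hJk, Ideal.mem_span_singleton] at hy
    exact Ideal.mem_span_singleton.mpr (mul_dvd_mul_left _ hy)
  · rw [Ideal.span_singleton_le_iff_mem]
    have hmem : ∏ j, π j ^ k j ∈ J := hJk ▸ Ideal.mem_span_singleton_self _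
    exact hmem

variable {e P : ℕ} {c : A}

/-- The complementary product with exponents `e * P - k l` kills the divisor, hence the multiple;
`hzero` then bounds the exponents. -/
lemma le_of_prod_pow_dvd (hzero : ∀ k : ι → ℕ, ∏ l, π l ^ k l = 0 ↔ ∀ l, e * P ≤ k l)
    {k m : ι → ℕ} (hk : ∀ l, k l ≤ e * P) (h : ∏ l, π l ^ k l ∣ ∏ l, π l ^ m l) (l : ι) :
    k l ≤ m l := by
  obtain ⟨x, hx⟩ := h
  have h0 : (∏ l, π l ^ k l) * ∏ l, π l ^ (e * P - k l) = 0 := by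
    rw [prod_pow_mul_prod_pow, hzero]
    intro j
    have := hk j
    omega
  have h1 : ∏ l, π l ^ (m l + (e * P - k l)) = 0 := by
    rw [← prod_pow_mul_prod_pow, hx, mul_right_comm, h0, zero_mul]
  have := (hzero _).mp h1 l
  have := hk l
  omega

lemma associated_pow_prod_pow (hc : Associated c (∏ l, π l ^ P)) (i : ℕ) :
    Associated (c ^ i) (∏ l, π l ^ (i * P)) := by
  have := hc.pow_pow (n := i)
  rw [← Finset.prod_pow] at this
  simpa only [← pow_mul, mul_comm P i] using this

lemma tau_le {k i m : ℕ} (h : k ≤ i * P + m) : tau P k i ≤ m := by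
  rw [tau, add_mul, one_mul]
  omega

lemma le_tau {k i m : ℕ} (h : m ≤ k - i * P) (h' : m ≤ P) : m ≤ tau P k i := by
  rw [tau, add_mul, one_mul]
  omega

/-- Replacing `a` by a product with exponents `m l` that generates the same ideal, the hypothesis
becomes `k l ≤ i * P + m l`. -/
lemma prod_pow_tau_dvd
    (hπ : ∀ l, ∀ M : Ideal A, M.IsMaximal → π l ∈ M → M = Ideal.span {π l})
    (hzero : ∀ k : ι → ℕ, ∏ l, π l ^ k l = 0 ↔ ∀ l, e * P ≤ k l)
    (hc : Associated c (∏ l, π l ^ P)) {k : ι → ℕ} (hk : ∀ l, k l ≤ e * P) {i : ℕ} {a : A}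
    (h : ∏ l, π l ^ k l ∣ c ^ i * a) : ∏ l, π l ^ tau P (k l) i ∣ a := by
  obtain ⟨m, -, hm⟩ := exists_eq_span_prod_pow hπ (fun _ => e * P) (Ideal.span {a}) (by
    rw [(hzero _).mpr fun _ => le_rfl]
    exact Ideal.zero_mem _)
  have hma : ∏ l, π l ^ m l ∣ a :=
    Ideal.mem_span_singleton.mp (hm ▸ Ideal.mem_span_singleton_self a)
  have ham : a ∣ ∏ l, π l ^ m l :=
    Ideal.mem_span_singleton.mp (hm.symm ▸ Ideal.mem_span_singleton_self _)
  have hkm := h.trans (mul_dvd_mul (associated_pow_prod_pow hc i).dvd ham)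
  rw [prod_pow_mul_prod_pow] at hkm
  refine (prod_pow_dvd_prod_pow fun l => ?_).trans hma
  exact tau_le (le_of_prod_pow_dvd hzero hk hkm l)

/-- The ideal generated by `∏ π l ^ (k l - i * P)` and `c` contains `∏ π l ^ tau P (k l) i`, hence
`z`. The part of `z` along the first generator is the required `a`. -/
lemma exists_prod_pow_dvd_pow_mul
    (hπ : ∀ l, ∀ M : Ideal A, M.IsMaximal → π l ∈ M → M = Ideal.span {π l})
    (hzero : ∀ k : ι → ℕ, ∏ l, π l ^ k l = 0 ↔ ∀ l, e * P ≤ k l)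
    (hc : Associated c (∏ l, π l ^ P)) {k : ι → ℕ} {i : ℕ} {z : A}
    (h : ∏ l, π l ^ tau P (k l) i ∣ z) :
    ∃ a, ∏ l, π l ^ k l ∣ c ^ i * a ∧ c ∣ z - a := by
  obtain ⟨m, hmK, hm⟩ := exists_eq_span_prod_pow hπ (fun _ => e * P)
    (Ideal.span {∏ l, π l ^ (k l - i * P), c}) (by
      rw [(hzero _).mpr fun _ => le_rfl]
      exact Ideal.zero_mem _)
  have h1 : ∏ l, π l ^ m l ∣ ∏ l, π l ^ (k l - i * P) :=
    Ideal.mem_span_singleton.mp (hm ▸ Ideal.subset_span (by simp))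
  have h2 : ∏ l, π l ^ m l ∣ ∏ l, π l ^ P :=
    (Ideal.mem_span_singleton.mp (hm ▸ Ideal.subset_span (by simp))).trans hc.dvd
  have hmt : ∏ l, π l ^ m l ∣ ∏ l, π l ^ tau P (k l) i :=
    prod_pow_dvd_prod_pow fun l => le_tau (le_of_prod_pow_dvd hzero hmK h1 l)
      (le_of_prod_pow_dvd hzero hmK h2 l)
  have hz : z ∈ Ideal.span {∏ l, π l ^ (k l - i * P), c} := by
    rw [hm]
    exact Ideal.mem_span_singleton.mpr (hmt.trans h)
  obtain ⟨x, y, rfl⟩ := Ideal.mem_span_pair.mp hz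
  refine ⟨x * ∏ l, π l ^ (k l - i * P), ?_, ⟨y, by ring⟩⟩
  rw [mul_left_comm]
  refine Dvd.dvd.mul_left ?_ x
  refine Dvd.dvd.trans ?_ (mul_dvd_mul_right (associated_pow_prod_pow hc i).symm.dvd _)
  rw [prod_pow_mul_prod_pow]
  exact prod_pow_dvd_prod_pow fun l => by omega

end PrincipalMaximal

/-! ### Arithmetic of the chain ring -/

section ChainRing

variable {R : Type*} [CommRing R] {γ : R}

lemma IsChainRing.isLocalRing (hR : IsChainRing R) (hγ : (Ideal.span {γ} : Ideal R).IsMaximal) :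
    IsLocalRing R := by
  refine IsLocalRing.of_unique_max_ideal ⟨_, hγ, fun M hM => ?_⟩
  rcases hR.2 M (Ideal.span {γ}) with h | h
  · exact hM.eq_of_le hγ.ne_top h
  · exact (hγ.eq_of_le hM.ne_top h).symm

lemma res_eq_zero_iff {x : R} : res γ x = 0 ↔ γ ∣ x := by
  rw [Ideal.Quotient.eq_zero_iff_mem, Ideal.mem_span_singleton]

lemma isUnit_iff_res_ne_zero (hR : IsChainRing R) (hγ : (Ideal.span {γ} : Ideal R).IsMaximal)
    {x : R} : IsUnit x ↔ res γ x ≠ 0 := by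
  have := hR.isLocalRing hγ
  rw [ne_eq, Ideal.Quotient.eq_zero_iff_mem, IsLocalRing.eq_maximalIdeal hγ,
    IsLocalRing.mem_maximalIdeal, mem_nonunits_iff, not_not]

lemma isNilpotent_of_isMaximal_span [Finite R] (hR : IsChainRing R)
    (hγ : (Ideal.span {γ} : Ideal R).IsMaximal) : IsNilpotent γ := by
  have := hR.isLocalRing hγ
  obtain ⟨n, hn⟩ := IsArtinianRing.isNilpotent_jacobson_bot (R := R)
  rw [IsLocalRing.jacobson_eq_maximalIdeal _ bot_ne_top, ← IsLocalRing.eq_maximalIdeal hγ,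
    Ideal.span_singleton_pow] at hn
  exact ⟨n, Ideal.span_singleton_eq_bot.mp hn⟩

lemma res_eq_zero_of_pow_mul_eq_zero (hR : IsChainRing R)
    (hγ : (Ideal.span {γ} : Ideal R).IsMaximal) {t : ℕ} (ht : γ ^ t ≠ 0) {x : R}
    (h : γ ^ t * x = 0) : res γ x = 0 := by
  by_contra hx
  rw [← ne_eq, ← isUnit_iff_res_ne_zero hR hγ] at hx
  exact ht (hx.mul_left_eq_zero.mp h)

/-- Otherwise `γ ^ t = x * y` with `y` a nonunit, so `γ ∣ y` and `γ ^ t = 0`. For `t = e - 1` this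
says that the annihilator of `γ` lies in `⟨γ ^ (e - 1)⟩`. -/
lemma pow_dvd_of_mul_eq_zero (hR : IsChainRing R)
    (hγ : (Ideal.span {γ} : Ideal R).IsMaximal) {t : ℕ} (ht : γ ^ t ≠ 0) {x : R}
    (h : γ * x = 0) : γ ^ t ∣ x := by
  rcases hR.2 (Ideal.span {x}) (Ideal.span {γ ^ t}) with hx | hx
  · exact Ideal.span_singleton_le_span_singleton.mp hx
  · obtain ⟨y, hy⟩ := Ideal.span_singleton_le_span_singleton.mp hx
    by_cases hyu : res γ y = 0
    · obtain ⟨z, rfl⟩ := res_eq_zero_iff.mp hyu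
      exact absurd (by rw [hy, ← mul_assoc, mul_comm x, h, zero_mul]) ht
    · obtain ⟨u, rfl⟩ := (isUnit_iff_res_ne_zero hR hγ).mpr hyu
      exact ⟨↑u⁻¹, by rw [hy, Units.mul_inv_cancel_right]⟩

end ChainRing

/-! ### Reduction modulo `γ` -/

section Reduction

variable {R : Type*} [CommRing R] {γ : R} {N : ℕ} {lam : R}

variable (γ N lam) in
/-- Coefficientwise reduction modulo `γ`. -/
noncomputable def reduction : QuotRing N lam →+* QuotRing N (res γ lam) :=
  Ideal.quotientMap _ (mapRingHom (res γ)) (by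
    rw [Ideal.span_le, Set.singleton_subset_iff]
    change mapRingHom (res γ) (X ^ N - C lam) ∈ Ideal.span {X ^ N - C (res γ lam)}
    rw [map_sub, map_pow, coe_mapRingHom, map_X, map_C]
    exact Ideal.mem_span_singleton_self _)

lemma reduction_quotMk (g : R[X]) :
    reduction γ N lam (quotMk N lam g) = quotMk N (res γ lam) (g.map (res γ)) := rfl

lemma map_toPoly (a : Fin N → R) :
    (toPoly a).map (res γ) = toPoly (fun j => res γ (a j)) := by
  ext m
  rw [coeff_map, coeff_toPoly, coeff_toPoly]
  split_ifs
  · rfl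
  · exact map_zero _

lemma reduction_toQuot (a : Fin N → R) :
    reduction γ N lam (toQuot N lam a) = toQuot N (res γ lam) (fun j => res γ (a j)) := by
  rw [toQuot_apply, toQuot_apply, reduction_quotMk, map_toPoly]

lemma reduction_eq_zero_iff [Nontrivial R] [Nontrivial (Res γ)] (hN : N ≠ 0)
    {z : QuotRing N lam} : reduction γ N lam z = 0 ↔ quotMk N lam (C γ) ∣ z := by
  constructor
  · intro h
    obtain ⟨a, rfl⟩ := toQuot_surjective hN z
    rw [reduction_toQuot] at h
    have h0 := toQuot_injective hN (h.trans (map_zero _).symm)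
    choose b hb using fun j => res_eq_zero_iff.mp (congrFun h0 j)
    refine ⟨toQuot N lam b, ?_⟩
    rw [← smul_eq_quotMk_mul, ← map_smul]
    exact congrArg _ (funext hb)
  · rintro ⟨w, rfl⟩
    rw [map_mul, reduction_quotMk, map_C, res_eq_zero_iff.mpr dvd_rfl, C_0, map_zero, zero_mul]

lemma quotMk_C_dvd_of_pow_mul_eq_zero (hR : IsChainRing R)
    (hγ : (Ideal.span {γ} : Ideal R).IsMaximal) (hN : N ≠ 0) {t : ℕ} (ht : γ ^ t ≠ 0)
    {z : QuotRing N lam} (h : quotMk N lam (C γ) ^ t * z = 0) : quotMk N lam (C γ) ∣ z := by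
  have := hR.1
  have := Ideal.Quotient.nontrivial_iff.mpr hγ.ne_top
  obtain ⟨a, rfl⟩ := toQuot_surjective hN z
  rw [← reduction_eq_zero_iff hN, reduction_toQuot]
  rw [← map_pow, ← C_pow, ← smul_eq_quotMk_mul, ← map_smul] at h
  have h0 := toQuot_injective hN (h.trans (map_zero _).symm)
  rw [← map_zero (toQuot N (res γ lam))]
  congr 1
  ext j
  exact res_eq_zero_of_pow_mul_eq_zero hR hγ ht (congrFun h0 j)

lemma exists_map_res_eq (g : (Res γ)[X]) : ∃ h : R[X], h.map (res γ) = g :=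
  map_surjective _ Ideal.Quotient.mk_surjective g

lemma C_dvd_of_map_res_eq_zero {g : R[X]} (h : g.map (res γ) = 0) : C γ ∣ g := by
  rw [C_dvd_iff_dvd_coeff]
  intro m
  rw [← res_eq_zero_iff, ← coeff_map, h, coeff_zero]

end Reduction

/-! ### The relation between `γ` and the factors, and maximal ideals -/

section Structure

variable {R : Type*} [CommRing R] {γ : R} {p n s e r : ℕ} {lam α₀ β : R} {f : Fin r → R[X]}

lemma natCast_eq_zero_of_card_eq_prime_pow {F : Type*} [Ring F] [IsDomain F] {p m : ℕ}
    (hcard : Nat.card F = p ^ m) : (p : F) = 0 := by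
  have h : ((p ^ m : ℕ) : F) = 0 := by
    rw [← hcard, ← nsmul_one]
    exact card_nsmul_eq_zero'
  rw [Nat.cast_pow] at h
  exact eq_zero_of_pow_eq_zero h

/-- Modulo `x ^ (n p ^ s) - lam`, the element `(x ^ n - α₀) ^ (p ^ s)` is a unit times `γ`. -/
lemma associated_quotMk_C_pow (hp : p.Prime) (hpγ : γ ∣ (p : R)) (hnil : IsNilpotent γ)
    (hβ : IsUnit β) (hlam : lam = α₀ ^ p ^ s + γ * β) :
    Associated (quotMk (n * p ^ s) lam (C γ))
      (quotMk (n * p ^ s) lam (X ^ n - C α₀) ^ p ^ s) := by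
  set q := quotMk (n * p ^ s) lam with hq
  set y := q (X ^ n - C α₀) with hy
  obtain ⟨u, hu⟩ := hpγ
  obtain ⟨t, ht⟩ := exists_add_pow_prime_pow_eq hp y (q (C α₀)) s
  have hX : (y + q (C α₀)) ^ p ^ s = q (C lam) := by
    rw [hy, ← map_add, sub_add_cancel, map_pow, ← pow_mul]
    exact quotMk_X_pow
  have hpq : (p : QuotRing (n * p ^ s) lam) = q (C γ) * q (C u) := by
    rw [← map_mul, ← C_mul, ← hu, C_eq_natCast, map_natCast]
  have hqlam : q (C lam) = q (C α₀) ^ p ^ s + q (C γ) * q (C β) := by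
    rw [← map_pow, ← map_mul, ← map_add, ← C_pow, ← C_mul, ← C_add, ← hlam]
  rw [hX, hqlam, hpq] at ht
  have key : y ^ p ^ s = q (C γ) * (q (C β) + y * -(q (C u) * q (C α₀) * t)) := by
    linear_combination -ht
  have hγnil : IsNilpotent (q (C γ)) := (hnil.map C).map q
  -- The identity `key` makes `y ^ p ^ s` a multiple of the nilpotent `γ`; its second factor is thus
  -- a unit plus a nilpotent.
  have hynil : IsNilpotent y := by
    obtain ⟨k, hk⟩ := hγnil
    exact ⟨p ^ s * k, by rw [pow_mul, key, mul_pow, hk, zero_mul]⟩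
  have hunit : IsUnit (q (C β) + y * -(q (C u) * q (C α₀) * t)) :=
    ((Commute.all _ _).isNilpotent_mul_right hynil).isUnit_add_left_of_commute
      ((hβ.map C).map q) (Commute.all _ _)
  rw [key]
  exact (associated_mul_unit_right _ _ hunit)

/-- Here `γ ∈ M`. For `h ∈ M`, either the reduction of `g` divides that of `h`, so `h ∈ ⟨g, γ⟩ =
⟨g⟩`, or a lifted Bézout relation puts `1` in `M`. -/
lemma eq_span_quotMk_of_mem {N : ℕ} (hγ : (Ideal.span {γ} : Ideal R).IsMaximal) {g : R[X]}
    (hirr : Irreducible (g.map (res γ))) (hg : quotMk N lam g ∣ quotMk N lam (C γ))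
    (M : Ideal (QuotRing N lam)) (hM : M.IsMaximal) (hgM : quotMk N lam g ∈ M) :
    M = Ideal.span {quotMk N lam g} := by
  refine le_antisymm (fun z hz => ?_) ((Ideal.span_singleton_le_iff_mem _).mpr hgM)
  rw [Ideal.mem_span_singleton]
  obtain ⟨h, rfl⟩ := Ideal.Quotient.mk_surjective z
  have hγM : quotMk N lam (C γ) ∈ M := M.mem_of_dvd hg hgM
  by_cases hd : g.map (res γ) ∣ h.map (res γ)
  · obtain ⟨k, hk⟩ := hd
    obtain ⟨k, rfl⟩ := exists_map_res_eq k
    obtain ⟨w, hw⟩ := C_dvd_of_map_res_eq_zero (g := h - g * k) (by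
      rw [Polynomial.map_sub, Polynomial.map_mul, hk, sub_self])
    rw [eq_add_of_sub_eq hw, map_add, map_mul, map_mul]
    exact dvd_add (hg.mul_right _) (Dvd.intro _ rfl)
  · let _ := Ideal.Quotient.field (Ideal.span {γ})
    obtain ⟨a, b, hab⟩ := (hirr.coprime_iff_not_dvd).mpr hd
    obtain ⟨a, rfl⟩ := exists_map_res_eq a
    obtain ⟨b, rfl⟩ := exists_map_res_eq b
    obtain ⟨w, hw⟩ := C_dvd_of_map_res_eq_zero (g := a * g + b * h - 1) (by
      rw [Polynomial.map_sub, Polynomial.map_add, Polynomial.map_mul, Polynomial.map_mul, hab,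
        Polynomial.map_one, sub_self])
    refine absurd ((Ideal.eq_top_iff_one M).mpr ?_) hM.ne_top
    have h1 : (1 : R[X]) = a * g + b * h - C γ * w := by rw [← hw, sub_sub_cancel]
    rw [← map_one (quotMk N lam), h1, map_sub, map_add, map_mul, map_mul, map_mul]
    exact M.sub_mem (M.add_mem (M.mul_mem_left _ hgM) (M.mul_mem_left _ hz))
      (M.mul_mem_right _ hγM)

/-- A product of powers of pairwise coprime irreducible polynomials is divisible by the product of
the `P`-th powers only if all exponents are at least `P`. -/
lemma le_of_prod_pow_dvd_prod_pow {F ι : Type*} [Field F] [Fintype ι] {g : ι → F[X]}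
    (hirr : ∀ l, Irreducible (g l)) (hcop : ∀ l l', l ≠ l' → IsCoprime (g l) (g l'))
    {k m : ι → ℕ} (h : ∏ l, g l ^ k l ∣ ∏ l, g l ^ m l) (l : ι) : k l ≤ m l := by
  classical
  have hl : g l ^ k l ∣ ∏ l, g l ^ m l :=
    (Finset.dvd_prod_of_mem (fun l => g l ^ k l) (Finset.mem_univ l)).trans h
  rw [← Finset.mul_prod_erase _ _ (Finset.mem_univ l)] at hl
  have hc : IsCoprime (g l ^ k l) (∏ j ∈ Finset.univ.erase l, g j ^ m j) :=
    IsCoprime.prod_right fun j hj => (hcop l j (Finset.ne_of_mem_erase hj).symm).pow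
  exact (pow_dvd_pow_iff (hirr l).ne_zero (hirr l).not_isUnit).mp (hc.dvd_of_dvd_mul_right hl)

end Structure

/-! ### Torsion codes and the least degree of a codeword -/

section Codes

variable {R : Type*} [CommRing R] {γ : R} {N P e r : ℕ} {lam : R} {f : Fin r → R[X]}

lemma quotMk_dvd_quotMk_iff {g h : R[X]} (hg : g ∣ X ^ N - C lam) :
    quotMk N lam g ∣ quotMk N lam h ↔ g ∣ h := by
  constructor
  · rintro ⟨z, hz⟩
    obtain ⟨k, rfl⟩ := Ideal.Quotient.mk_surjective z
    rw [← map_mul, quotMk_eq_iff] at hz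
    exact (dvd_sub_left (Dvd.intro _ rfl)).mp (hg.trans hz)
  · exact map_dvd _

lemma X_pow_sub_C_res_eq_prod {p n s : ℕ} {α₀ β : R} (hp : p.Prime)
    (hγ : (Ideal.span {γ} : Ideal R).IsMaximal) (hpγ : γ ∣ (p : R))
    (hlam : lam = α₀ ^ p ^ s + γ * β) (hf : ∏ l, f l = X ^ n - C α₀) :
    X ^ (n * p ^ s) - C (res γ lam) = ∏ l, (f l).map (res γ) ^ p ^ s := by
  have := Ideal.Quotient.nontrivial_iff.mpr hγ.ne_top
  have := hγ.isPrime
  have := Fact.mk hp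
  have : CharP (Res γ) p := (CharP.charP_iff_prime_eq_zero hp).mpr (by
    rw [← map_natCast (res γ), res_eq_zero_iff]
    exact hpγ)
  have hlam' : res γ lam = res γ α₀ ^ p ^ s := by
    rw [hlam, map_add, map_pow, res_eq_zero_iff.mpr (Dvd.intro β rfl), add_zero]
  rw [Finset.prod_pow, ← Polynomial.map_prod, hf, Polynomial.map_sub, Polynomial.map_pow, map_X,
    map_C, sub_pow_char_pow, ← pow_mul, hlam', C_pow]

lemma prod_pow_eq_zero_iff (hR : IsChainRing R) (hγ : (Ideal.span {γ} : Ideal R).IsMaximal)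
    (hN : N ≠ 0) (hP : P ≠ 0) (he : e ≠ 0) (hγe : γ ^ e = 0) (hγe' : γ ^ (e - 1) ≠ 0)
    (hirr : ∀ l, Irreducible ((f l).map (res γ)))
    (hcop : ∀ l l', l ≠ l' → IsCoprime (f l) (f l'))
    (hc : Associated (quotMk N lam (C γ)) (∏ l, quotMk N lam (f l) ^ P))
    (hred : X ^ N - C (res γ lam) = ∏ l, (f l).map (res γ) ^ P) (k : Fin r → ℕ) :
    ∏ l, quotMk N lam (f l) ^ k l = 0 ↔ ∀ l, e * P ≤ k l := by
  constructor
  · intro h l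
    by_contra hl
    -- Enlarging exponents makes the vanishing product `γ ^ (e - 1)` times `∏ f_j ^ m j` up to a
    -- unit. So `γ` divides the latter, and reduction would force `P ≤ m l = P - 1`.
    set m : Fin r → ℕ := fun j => if j = l then P - 1 else P + k j with hm
    have hml : m l = P - 1 := if_pos rfl
    have heP : e * P = (e - 1) * P + P := by
      rw [← Nat.succ_mul, Nat.succ_eq_add_one, Nat.sub_add_cancel (Nat.pos_of_ne_zero he)]
    have h1 : ∏ l, quotMk N lam (f l) ^ ((e - 1) * P + m l) = 0 := by
      refine eq_zero_of_zero_dvd (h ▸ prod_pow_dvd_prod_pow fun j => ?_)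
      by_cases hj : j = l
      · subst hj
        omega
      · have : m j = P + k j := if_neg hj
        omega
    have h2 : quotMk N lam (C γ) ^ (e - 1) * ∏ l, quotMk N lam (f l) ^ m l = 0 := by
      rw [← prod_pow_mul_prod_pow] at h1
      exact ((associated_pow_prod_pow hc (e - 1)).mul_right _).eq_zero_iff.mpr h1
    have h3 := quotMk_C_dvd_of_pow_mul_eq_zero hR hγ hN hγe' h2
    have := hR.1
    have := Ideal.Quotient.nontrivial_iff.mpr hγ.ne_top
    rw [← reduction_eq_zero_iff hN, map_prod] at h3
    simp only [map_pow, reduction_quotMk] at h3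
    simp only [← map_pow] at h3
    rw [← map_prod, quotMk_eq_zero_iff, hred] at h3
    let _ := Ideal.Quotient.field (Ideal.span {γ})
    have := le_of_prod_pow_dvd_prod_pow hirr
      (fun l l' hl => (hcop l l' hl).map (mapRingHom (res γ))) h3 l
    omega
  · intro h
    refine eq_zero_of_zero_dvd (dvd_trans ?_ (prod_pow_dvd_prod_pow h))
    rw [zero_dvd_iff, ← (associated_pow_prod_pow hc e).eq_zero_iff, ← map_pow, ← C_pow, hγe, C_0,
      map_zero]

lemma reduction_prod_pow (k : Fin r → ℕ) :
    reduction γ N lam (∏ l, quotMk N lam (f l) ^ k l) =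
      quotMk N (res γ lam) (∏ l, (f l).map (res γ) ^ k l) := by
  rw [map_prod, map_prod]
  refine Finset.prod_congr rfl fun l _ => ?_
  rw [map_pow, map_pow, reduction_quotMk]

lemma mem_codeGen_prod_pow {k : Fin r → ℕ} {a : Fin N → R} :
    a ∈ codeGen N lam (∏ l, f l ^ k l) ↔ ∏ l, quotMk N lam (f l) ^ k l ∣ toQuot N lam a := by
  rw [mem_codeGen, map_prod]
  simp only [map_pow]

lemma toQuot_pow_smul (i : ℕ) (a : Fin N → R) :
    toQuot N lam (γ ^ i • a) = quotMk N lam (C γ) ^ i * toQuot N lam a := by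
  rw [map_smul, smul_eq_quotMk_mul, C_pow, map_pow]

lemma torsionCode_codeGen [Nontrivial R] (hγ : (Ideal.span {γ} : Ideal R).IsMaximal) (hN : N ≠ 0)
    (hπ : ∀ l, ∀ M : Ideal (QuotRing N lam), M.IsMaximal → quotMk N lam (f l) ∈ M →
      M = Ideal.span {quotMk N lam (f l)})
    (hzero : ∀ k : Fin r → ℕ, ∏ l, quotMk N lam (f l) ^ k l = 0 ↔ ∀ l, e * P ≤ k l)
    (hc : Associated (quotMk N lam (C γ)) (∏ l, quotMk N lam (f l) ^ P))
    {k : Fin r → ℕ} (hk : ∀ l, k l ≤ e * P) (i : ℕ) :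
    torsionCode γ i (codeGen N lam (∏ l, f l ^ k l)) =
      codeGen N (res γ lam) (∏ l, (f l).map (res γ) ^ tau P (k l) i) := by
  have := Ideal.Quotient.nontrivial_iff.mpr hγ.ne_top
  ext b
  rw [SetLike.mem_coe, mem_codeGen, ← reduction_prod_pow]
  constructor
  · rintro ⟨a, ha, rfl⟩
    rw [mem_codeGen_prod_pow, toQuot_pow_smul] at ha
    rw [← reduction_toQuot]
    exact map_dvd _ (prod_pow_tau_dvd hπ hzero hc hk ha)
  · rintro ⟨y, hy⟩
    obtain ⟨g, rfl⟩ := Ideal.Quotient.mk_surjective y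
    obtain ⟨h, rfl⟩ := exists_map_res_eq g
    -- An arbitrary lift of `b` need not work; it is corrected by a multiple of `γ` so that `γ ^ i`
    -- times it lies in the code.
    obtain ⟨z, hz, hzd⟩ := exists_prod_pow_dvd_pow_mul (i := i) (k := k) hπ hzero hc
      (Dvd.intro (quotMk N lam h) rfl)
    obtain ⟨a, rfl⟩ := toQuot_surjective hN z
    refine ⟨a, ?_, ?_⟩
    · rwa [mem_codeGen_prod_pow, toQuot_pow_smul]
    · refine toQuot_injective (lam := res γ lam) hN ?_
      rw [← reduction_eq_zero_iff hN, map_sub, sub_eq_zero, map_mul, reduction_quotMk] at hzd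
      rw [hy, ← reduction_toQuot]
      exact hzd

lemma depthSpectrum_eq_Icc_of_torsionCode (hR : IsChainRing R)
    (hγ : (Ideal.span {γ} : Ideal R).IsMaximal) (hN : N ≠ 0) (hlam : IsUnit (1 - lam))
    (he : e ≠ 0) (hγe : γ ^ e = 0) (hγe' : γ ^ (e - 1) ≠ 0) {Co : Submodule R (Fin N → R)}
    (hCo : IsConstacyclic lam Co) {g : (Res γ)[X]} (hg : g.Monic)
    (hgd : g ∣ X ^ N - C (res γ lam))
    (htor : torsionCode γ (e - 1) Co = codeGen N (res γ lam) g) :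
    depthSpectrum Co = Set.Icc (g.natDegree + 1) N := by
  have := hR.1
  have := Ideal.Quotient.nontrivial_iff.mpr hγ.ne_top
  obtain ⟨I, hI⟩ := hCo.exists_ideal hN
  have hmem : ∀ b, b ∈ torsionCode γ (e - 1) Co ↔ g ∣ toPoly b := by
    intro b
    rw [htor, SetLike.mem_coe, mem_codeGen, toQuot_apply, quotMk_dvd_quotMk_iff hgd]
  have hγγ : ∀ x : R, res γ x = 0 → γ ^ (e - 1) * x = 0 := by
    intro x hx
    obtain ⟨y, rfl⟩ := res_eq_zero_iff.mp hx
    rw [← mul_assoc, ← pow_succ, Nat.sub_add_cancel (Nat.pos_of_ne_zero he), hγe, zero_mul]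
  refine depthSpectrum_eq_Icc hN hlam hI ?_ ?_ ?_
  · have hmo := monic_X_pow_sub_C (res γ lam) hN
    obtain ⟨h, hh⟩ := hgd
    have hh0 : h ≠ 0 := by
      rintro rfl
      exact hmo.ne_zero (by rw [hh, mul_zero])
    have := congrArg natDegree hh
    rw [natDegree_X_pow_sub_C, hg.natDegree_mul' hh0] at this
    omega
  · intro a ha haS
    by_contra ha0
    -- The last nonzero multiple `γ ^ t • a` is killed by `γ`, so it is `γ ^ (e - 1) • v`. The
    -- reduction of `v` is a multiple of `g` of degree below that of `g`, hence zero.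
    have hex : ∃ t, γ ^ t • a = 0 := ⟨e, by rw [hγe, zero_smul]⟩
    classical
    obtain ⟨t, ht⟩ : ∃ t, Nat.find hex = t + 1 := by
      refine Nat.exists_eq_succ_of_ne_zero fun h0 => ha0 ?_
      have := Nat.find_spec hex
      rwa [h0, pow_zero, one_smul] at this
    have hw0 : γ ^ t • a ≠ 0 := Nat.find_min hex (by omega)
    have hw : ∀ j, γ * (γ ^ t • a) j = 0 := by
      intro j
      have := congrFun (Nat.find_spec hex) j
      rw [ht] at this
      rw [Pi.smul_apply, smul_eq_mul, ← mul_assoc, ← pow_succ']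
      exact this
    choose v hv using fun j => pow_dvd_of_mul_eq_zero hR hγ hγe' (hw j)
    have hvt : (fun j => res γ (v j)) ∈ torsionCode γ (e - 1) Co := by
      refine ⟨v, ?_, rfl⟩
      rw [← show γ ^ t • a = γ ^ (e - 1) • v from funext hv]
      exact Co.smul_mem _ ha
    rw [hmem] at hvt
    have hz : toPoly (fun j => res γ (v j)) = 0 := by
      by_contra hne
      refine hg.not_dvd_of_degree_lt hne ?_ hvt
      rw [degree_eq_natDegree hg.ne_zero, degree_lt_iff_coeff_zero]
      intro m hm
      rw [coeff_toPoly]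
      split_ifs with hmN
      · refine res_eq_zero_of_pow_mul_eq_zero hR hγ hγe' ?_
        rw [← hv, Pi.smul_apply, haS _ hm, smul_zero]
      · rfl
    refine hw0 (funext fun j => ?_)
    rw [hv]
    refine hγγ _ ?_
    rw [← toPoly_coeff_fin (fun j => res γ (v j)) j, hz, coeff_zero]
  · intro hS
    -- The word of least degree is `γ ^ (e - 1) • a`, where `a` reduces to `g` itself; monicity of
    -- `g` keeps it nonzero.
    obtain ⟨b, hb⟩ := exists_toPoly (g := g) (N := N) (by
      rw [degree_eq_natDegree hg.ne_zero]
      exact_mod_cast hS)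
    obtain ⟨a, ha, rfl⟩ := (hmem b).mpr hb.symm.dvd
    refine ⟨_, ha, fun h0 => ?_, fun j hj => hγγ _ ?_⟩
    · have h1 := res_eq_zero_of_pow_mul_eq_zero hR hγ hγe' (congrFun h0 ⟨_, hS⟩)
      have h2 := toPoly_coeff_fin (fun j => res γ (a j)) ⟨_, hS⟩
      rw [hb, h1] at h2
      exact one_ne_zero (hg.coeff_natDegree.symm.trans h2)
    · have h2 := toPoly_coeff_fin (fun j => res γ (a j)) j
      rw [hb, coeff_eq_zero_of_natDegree_lt hj] at h2
      exact h2.symm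

lemma tau_le_self (k i : ℕ) : tau P k i ≤ P := by
  rw [tau, add_mul, one_mul]
  omega

end Codes

end Constacyclic

/-! ### The main theorem -/

open Constacyclic in
theorem theorem3p2 {R : Type*} [CommRing R] [Finite R] (hR : Constacyclic.IsChainRing R)
    -- `γ` generates the maximal ideal and has nilpotency index `e`
    (γ : R) (hγ : (Ideal.span {γ} : Ideal R).IsMaximal) (e : ℕ) (he : nilpotencyClass γ = e)
    -- the residue field has `p ^ m` elements
    (p m : ℕ) (hp : p.Prime) (hcard : Nat.card (Constacyclic.Res γ) = p ^ m)
    -- `ζ` defines the Teichmüller set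
    (ζ : R) (hζ : orderOf ζ = p ^ m - 1)
    (α β lam : R) (hα : α ∈ Constacyclic.teichmullerSet (p ^ m) ζ) (hα0 : α ≠ 0)
    (hβ : IsUnit β) (hlam : lam = α + γ * β) (hlam1 : Constacyclic.res γ lam ≠ 1)
    (n s : ℕ) (hn : n.Coprime p)
    (α₀ : R) (hα₀ : α₀ ∈ Constacyclic.teichmullerSet (p ^ m) ζ) (hα₀s : α₀ ^ p ^ s = α)
    -- factorization of `x ^ n - α₀` into monic basic irreducible pairwise coprime factors
    (r : ℕ) (f : Fin r → R[X]) (hf : ∏ l, f l = X ^ n - C α₀)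
    (hmonic : ∀ l, (f l).Monic)
    (hirr : ∀ l, Irreducible ((f l).map (Constacyclic.res γ)))
    (hcop : ∀ l l', l ≠ l' → IsCoprime (f l) (f l'))
    (Co : Submodule R (Fin (n * p ^ s) → R)) (hCo : Constacyclic.IsConstacyclic lam Co) :
    -- `Co` has a generator of the stated form
    (∃ k : Fin r → ℕ, (∀ l, k l ≤ e * p ^ s) ∧
      Co = Constacyclic.codeGen (n * p ^ s) lam (∏ l, f l ^ k l)) ∧
    -- and every such generator determines the torsion codes and the depth spectrum
    ∀ k : Fin r → ℕ, (∀ l, k l ≤ e * p ^ s) →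
      Co = Constacyclic.codeGen (n * p ^ s) lam (∏ l, f l ^ k l) →
      (∀ i < e, Constacyclic.torsionCode γ i Co =
        Constacyclic.codeGen (n * p ^ s) (Constacyclic.res γ lam)
          (∏ l, (f l).map (Constacyclic.res γ) ^ Constacyclic.tau (p ^ s) (k l) i)) ∧
      (∏ l, (f l).map (Constacyclic.res γ) ^
        Constacyclic.tau (p ^ s) (k l) (e - 1)).natDegree = Constacyclic.sOne f k (p ^ s) e ∧
      Constacyclic.depthSpectrum Co =
        Set.Icc (Constacyclic.sOne f k (p ^ s) e + 1) (n * p ^ s) := by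
  have hRnt := hR.1
  have hresnt := Ideal.Quotient.nontrivial_iff.mpr hγ.ne_top
  have hprime := hγ.isPrime
  have hnil := isNilpotent_of_isMaximal_span hR hγ
  have hγe : γ ^ e = 0 := he ▸ pow_nilpotencyClass hnil
  have hγe' : γ ^ (e - 1) ≠ 0 := he ▸ pow_pred_nilpotencyClass hnil
  have he0 : e ≠ 0 := by
    rintro rfl
    exact one_ne_zero ((pow_zero γ).symm.trans hγe)
  have hn0 : n ≠ 0 := by
    rintro rfl
    exact hp.ne_one ((Nat.coprime_zero_left p).mp hn)
  have hP : p ^ s ≠ 0 := pow_ne_zero s hp.ne_zero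
  have hN : n * p ^ s ≠ 0 := mul_ne_zero hn0 hP
  have hpγ : γ ∣ (p : R) := by
    rw [← res_eq_zero_iff, map_natCast]
    exact natCast_eq_zero_of_card_eq_prime_pow hcard
  have hlam' : lam = α₀ ^ p ^ s + γ * β := by rw [hlam, hα₀s]
  have hunit : IsUnit (1 - lam) := by
    rw [isUnit_iff_res_ne_zero hR hγ, map_sub, map_one]
    exact sub_ne_zero.mpr hlam1.symm
  have hc : Associated (quotMk (n * p ^ s) lam (C γ))
      (∏ l, quotMk (n * p ^ s) lam (f l) ^ p ^ s) := by
    rw [Finset.prod_pow, ← map_prod, hf]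
    exact associated_quotMk_C_pow hp hpγ hnil hβ hlam'
  have hred := X_pow_sub_C_res_eq_prod hp hγ hpγ hlam' hf
  have hπ : ∀ l, ∀ M : Ideal (QuotRing (n * p ^ s) lam), M.IsMaximal →
      quotMk (n * p ^ s) lam (f l) ∈ M → M = Ideal.span {quotMk (n * p ^ s) lam (f l)} :=
    fun l => eq_span_quotMk_of_mem hγ (hirr l) (((dvd_pow_self _ hP).trans
      (Finset.dvd_prod_of_mem (fun l => quotMk (n * p ^ s) lam (f l) ^ p ^ s)
        (Finset.mem_univ l))).trans hc.symm.dvd)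
  have hzero := prod_pow_eq_zero_iff hR hγ hN hP he0 hγe hγe' hirr hcop hc hred
  refine ⟨?_, fun k hk hCok => ?_⟩
  · obtain ⟨I, hI⟩ := hCo.exists_ideal hN
    obtain ⟨k, hk, hIk⟩ := exists_eq_span_prod_pow hπ (fun _ => e * p ^ s) I (by
      rw [(hzero _).mpr fun _ => le_rfl]
      exact I.zero_mem)
    refine ⟨k, hk, ?_⟩
    ext a
    rw [hI, hIk, Ideal.mem_span_singleton, mem_codeGen_prod_pow]
  · have htor := torsionCode_codeGen hγ hN hπ hzero hc hk
    rw [← hCok] at htor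
    have hmon : ∀ l ∈ Finset.univ, ((f l).map (res γ) ^ tau (p ^ s) (k l) (e - 1)).Monic :=
      fun l _ => ((hmonic l).map _).pow _
    have hdeg : (∏ l, (f l).map (res γ) ^ tau (p ^ s) (k l) (e - 1)).natDegree =
        sOne f k (p ^ s) e := by
      rw [natDegree_prod_of_monic _ _ hmon, sOne]
      refine Finset.sum_congr rfl fun l _ => ?_
      rw [((hmonic l).map _).natDegree_pow, (hmonic l).natDegree_map, mul_comm]
    refine ⟨fun i _ => htor i, hdeg, ?_⟩
    rw [← hdeg]
    refine depthSpectrum_eq_Icc_of_torsionCode hR hγ hN hunit he0 hγe hγe' hCo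
      (monic_prod_of_monic _ _ hmon) ?_ (htor (e - 1))
    -- Since `τ ≤ p ^ s`, the torsion generator divides `x^N - λ` modulo `γ`, so its degree really
    -- is the least one.
    rw [hred]
    exact prod_pow_dvd_prod_pow fun l => tau_le_self _ _
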